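/- Let $N\ge 1$, let $\Omega\subset\mathbb R^N$ be a bounded open set, and let $J:\mathbb R^N\to\mathbb R$ be measurable with $J(z)>0$ for $z\ne0$, $J(-z)=J(z)$, $J\notin L^1(\{|z|<1\})$ and $\int_{\mathbb R^N}\min(1,|z|^{q_0})J(z)\,dz<\infty$ for some $q_0>0$; let $q_*$ be the infimum of all such $q_0>0$. Let $p\ge q>\max\{q_*,1\}$, and let $\Psi:\mathbb R\to[0,\infty)$ be convex, even and differentiable with $\Psi(0)=0$, $\Psi(1)=1$, $\Psi(s)>0$ and $q\le s\Psi'(s)/\Psi(s)\le p$ for all $s\ne0$. For a Young function $\Theta$ and measurable $D\subset\mathbb R^N$, let $L^{\Theta}(D)$ be the space of measurable $u$ on $D$ (modulo equality a.e.) with $\int_D\Theta(u)\,dx<\infty$, with the Luxemburg norm $\|u\|_{L^\Theta(D)}=\inf\{k>0:\int_D\Theta(u/k)\,dx\le1\}$. Put $$E(u)=\frac12\iint_{\mathbb R^{2N}}\Psi(u(x)-u(y))J(x-y)\,dx\,dy,$$ and let $W_0^{J,\Psi}(\Omega)$ be the space of all $u\in L^\Psi(\mathbb R^N)$ with $E(u)<\infty$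 and $u=0$ a.e. in $\mathbb R^N\setminus\Omega$, with the norm $\|u\|_{L^\Psi(\mathbb R^N)}+\inf\{k>0:E(u/k)\le1\}$. Assume that there are $\alpha>0$ and $c>0$ such that $$J(z)\ge c|z|^{-N-\alpha}\quad\text{for }0<|z|<1,$$ and that there is $c'>0$ such that $$J(z_1)\ge c'J(z_2)\quad\text{for all }0<|z_1|\le|z_2|\le1.$$ Then the embedding $W_0^{J,\Psi}(\Omega)\hookrightarrow L^{\Psi^r}(\Omega)$, where $\Psi^r(s)=\Psi(s)^r$, is well defined, bounded and compact (every bounded sequence in $W_0^{J,\Psi}(\Omega)$ has a subsequence converging in $L^{\Psi^r}(\Omega)$) for every $1\le r<\frac{N}{N-\alpha}$ if $\alpha<N$, and for every $1\le r<\infty$ if $\alpha\ge N$. -/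

import Mathlib

open MeasureTheory Filter Topology
open scoped ENNReal NNReal

namespace NonlocalOrlicz

/-- `ℝ^N` with its Euclidean norm. -/
abbrev Space (N : ℕ) : Type := EuclideanSpace ℝ (Fin N)

/-- The class `Γ_{p,q}` of Young functions: convex, even, differentiable functions `Ψ ≥ 0` with
`Ψ 0 = 0`, `Ψ 1 = 1` and `q ≤ s Ψ'(s) / Ψ(s) ≤ p` for all `s ≠ 0`.  The derivative `ψ = Ψ'` of
a differentiable convex function is automatically continuous and nondecreasing, and here it is odd
and (for `q > 1`) unbounded. -/
structure YoungClass (p q : ℝ) (Ψ : ℝ → ℝ) : Prop where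
  convex : ConvexOn ℝ Set.univ Ψ
  even : ∀ s, Ψ (-s) = Ψ s
  differentiable : Differentiable ℝ Ψ
  map_zero : Ψ 0 = 0
  map_one : Ψ 1 = 1
  pos : ∀ s, s ≠ 0 → 0 < Ψ s
  lower : ∀ s, s ≠ 0 → q ≤ s * deriv Ψ s / Ψ s
  upper : ∀ s, s ≠ 0 → s * deriv Ψ s / Ψ s ≤ p

/-- The integrability condition `∫ min(1, |z|^{q₀}) J(z) dz < ∞`. -/
def TailIntegrable {N : ℕ} (J : Space N → ℝ) (q₀ : ℝ) : Prop :=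
  Integrable (fun z => min 1 (‖z‖ ^ q₀) * J z) volume

/-- Admissible kernels.  The value at the origin, a null set where kernels are typically singular,
plays no role and is not restricted. -/
structure IsKernel {N : ℕ} (J : Space N → ℝ) : Prop where
  measurable : Measurable J
  pos : ∀ z, z ≠ 0 → 0 < J z
  even : ∀ z, J (-z) = J z
  not_integrable : ¬ IntegrableOn J (Metric.ball 0 1) volume
  tail : ∃ q₀ : ℝ, 0 < q₀ ∧ TailIntegrable J q₀

/-- `q_* = inf {q₀ > 0 : ∫ min(1, |z|^{q₀}) J(z) dz < ∞}`; for an admissible kernel the set is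
nonempty (and bounded below by `0`). -/
noncomputable def qStar {N : ℕ} (J : Space N → ℝ) : ℝ :=
  sInf {q₀ : ℝ | 0 < q₀ ∧ TailIntegrable J q₀}

/-- Power lower bound `J(z) ≥ c |z|^{-N-α}` for `0 < |z| < 1`, for some `c > 0`. -/
def PowerLowerBound {N : ℕ} (J : Space N → ℝ) (α : ℝ) : Prop :=
  ∃ c : ℝ, 0 < c ∧ ∀ z : Space N, 0 < ‖z‖ → ‖z‖ < 1 → c * ‖z‖ ^ (-(N : ℝ) - α) ≤ J z

/-- Monotonicity near the origin: `J(z₁) ≥ c J(z₂)` for `0 < |z₁| ≤ |z₂| ≤ 1`, some `c > 0`. -/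
def AlmostDecreasing {N : ℕ} (J : Space N → ℝ) : Prop :=
  ∃ c : ℝ, 0 < c ∧ ∀ z₁ z₂ : Space N, 0 < ‖z₁‖ → ‖z₁‖ ≤ ‖z₂‖ → ‖z₂‖ ≤ 1 → c * J z₂ ≤ J z₁

/-- The Orlicz modular `∫ Ψ(u) dμ ∈ [0, ∞]`. -/
noncomputable def modular {X : Type*} [MeasurableSpace X] (Ψ : ℝ → ℝ) (μ : Measure X)
    (u : X → ℝ) : ℝ≥0∞ :=
  ∫⁻ x, ENNReal.ofReal (Ψ (u x)) ∂μ

/-- The nonlocal energy `E(u) = 1/2 ∬ Ψ(u(x) - u(y)) J(x - y) dx dy ∈ [0, ∞]`. -/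
noncomputable def energy {N : ℕ} (J : Space N → ℝ) (Ψ : ℝ → ℝ) (u : Space N → ℝ) : ℝ≥0∞ :=
  (1 / 2) * ∫⁻ x : Space N, ∫⁻ y : Space N, ENNReal.ofReal (Ψ (u x - u y) * J (x - y))

/-- The Luxemburg functional `inf {k > 0 : M(u / k) ≤ 1} ∈ [0, ∞]` of a modular `M`
(it is `∞` if there is no such `k`). -/
noncomputable def luxemburg {X : Type*} (M : (X → ℝ) → ℝ≥0∞) (u : X → ℝ) : ℝ≥0∞ :=
  ⨅ (k : ℝ) (_ : 0 < k) (_ : M (fun x => u x / k) ≤ 1), ENNReal.ofReal k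

/-- Membership in the Orlicz space `L^Ψ(μ)`. -/
def MemOrlicz {X : Type*} [MeasurableSpace X] (Ψ : ℝ → ℝ) (μ : Measure X) (u : X → ℝ) : Prop :=
  AEMeasurable u μ ∧ modular Ψ μ u < ∞

/-- The Luxemburg norm of `L^Ψ(μ)`. -/
noncomputable def orliczNorm {X : Type*} [MeasurableSpace X] (Ψ : ℝ → ℝ) (μ : Measure X)
    (u : X → ℝ) : ℝ≥0∞ :=
  luxemburg (modular Ψ μ) u

/-- Membership in `W^{J,Ψ}(ℝ^N)`: `u ∈ L^Ψ(ℝ^N)` and `E(u) < ∞`. -/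
def MemW {N : ℕ} (J : Space N → ℝ) (Ψ : ℝ → ℝ) (u : Space N → ℝ) : Prop :=
  MemOrlicz Ψ volume u ∧ energy J Ψ u < ∞

/-- The norm of `W^{J,Ψ}(ℝ^N)`: the Luxemburg norm of `L^Ψ(ℝ^N)` plus the Luxemburg seminorm
associated with the energy. -/
noncomputable def wNorm {N : ℕ} (J : Space N → ℝ) (Ψ : ℝ → ℝ) (u : Space N → ℝ) : ℝ≥0∞ :=
  orliczNorm Ψ volume u + luxemburg (energy J Ψ) u

/-- Membership in `W_0^{J,Ψ}(Ω)`: `u ∈ W^{J,Ψ}(ℝ^N)` and `u = 0` (almost everywhere) outside `Ω`.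
Its norm is that of `W^{J,Ψ}(ℝ^N)`. -/
def MemW₀ {N : ℕ} (J : Space N → ℝ) (Ψ : ℝ → ℝ) (Ω : Set (Space N)) (u : Space N → ℝ) : Prop :=
  MemW J Ψ u ∧ ∀ᵐ x ∂volume, x ∉ Ω → u x = 0

/-- The embedding `W_0^{J,Ψ}(Ω) ↪ L^Θ(Ω)`, `u ↦ u|_Ω`, is well defined, bounded and compact:
every sequence bounded in the norm of `W_0^{J,Ψ}(Ω)` has a subsequence that converges in the
norm of `L^Θ(Ω)` to an element of `L^Θ(Ω)`. -/
structure CompactEmbedding {N : ℕ} (J : Space N → ℝ) (Ψ : ℝ → ℝ) (Ω : Set (Space N))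
    (Θ : ℝ → ℝ) : Prop where
  mem : ∀ u : Space N → ℝ, MemW₀ J Ψ Ω u → MemOrlicz Θ (volume.restrict Ω) u
  bounded : ∃ C : ℝ≥0, ∀ u : Space N → ℝ, MemW₀ J Ψ Ω u →
    orliczNorm Θ (volume.restrict Ω) u ≤ C * wNorm J Ψ u
  compact : ∀ u : ℕ → Space N → ℝ, (∀ n, MemW₀ J Ψ Ω (u n)) →
    (∃ K : ℝ≥0, ∀ n, wNorm J Ψ (u n) ≤ K) →
    ∃ φ : ℕ → ℕ, StrictMono φ ∧ ∃ v : Space N → ℝ, MemOrlicz Θ (volume.restrict Ω) v ∧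
      Tendsto (fun n => orliczNorm Θ (volume.restrict Ω) (fun x => u (φ n) x - v x)) atTop (𝓝 0)

end NonlocalOrlicz

namespace NonlocalOrlicz

/-! ### Growth and convexity estimates for `Ψ`. -/

namespace YoungClass

variable {p q : ℝ} {Ψ : ℝ → ℝ}

/-! Write `G(x) = ∫ Ψ(u(x) - u(y)) J(x - y) dy`, so that `∫ G = 2 E(u)`. The proof rests on two
pointwise consequences of `J(z) ≥ c |z|^(-N-α)`.

Gain of integrability (`exists_lintegral_rpow_le_of_lintegral_rpow_le`). If `∫ Ψ(u)^s ≤ C`,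
Chebyshev bounds the measure of `{|u| > |u(x)|/2}` by a multiple of `Ψ(u(x))^(-s)`. When `Ψ(u(x))`
is large, a ball about `x` of radius `δ ~ Ψ(u(x))^(-s/N)` therefore has at least half its volume
where `|u(y)| ≤ |u(x)|/2`, and there `Ψ(u(x) - u(y)) ≥ 2^(-p) Ψ(u(x))`. Hence `G(x)` is at least a
multiple of `Ψ(u(x)) δ^(-α) ~ Ψ(u(x))^(1 + αs/N)`. Iterating `s ↦ 1 + (α/N) s` from `s = 1` runs
through the partial sums of the geometric series of ratio `α/N`, whose supremum is `N/(N-α)` if `α <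
N` and infinity otherwise. Finitely many iterations thus bound `∫ Ψ(u)^s` for some `s > r`.

Compactness (`exists_subseq_tendsto_ae`). The difference between `u(x)` and its average over a small
cube is at most `ε` plus a small multiple of `G(x)`, so averaging approximates in `L¹(Ω)` uniformly
on bounded sets. The averages converge along a diagonal subsequence, which is then Cauchy in
`L¹(Ω)`, and a further subsequence converges a.e.

A.e. convergence and the bound at exponent `s > r` give convergence at exponent `r` by a Vitali
argument (`tendsto_modular_rpow_sub`). -/

theorem nonneg (h : YoungClass p q Ψ) (s : ℝ) : 0 ≤ Ψ s := by
  rcases eq_or_ne s 0 with rfl | hs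
  · exact h.map_zero.ge
  · exact (h.pos s hs).le

theorem map_abs (h : YoungClass p q Ψ) (s : ℝ) : Ψ |s| = Ψ s := by
  rcases abs_choice s with hs | hs <;> rw [hs]
  exact h.even s

theorem map_mul_le (h : YoungClass p q Ψ) {t : ℝ} (ht0 : 0 ≤ t) (ht1 : t ≤ 1) (s : ℝ) :
    Ψ (t * s) ≤ t * Ψ s := by
  have := h.convex.2 (Set.mem_univ s) (Set.mem_univ 0) ht0 (sub_nonneg.2 ht1) (by ring)
  simpa [h.map_zero] using this

theorem mono (h : YoungClass p q Ψ) {a b : ℝ} (hab : |a| ≤ |b|) : Ψ a ≤ Ψ b := by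
  rcases eq_or_ne b 0 with rfl | hb
  · have : a = 0 := by simpa using hab
    rw [this]
  have hb' : 0 < |b| := abs_pos.2 hb
  have h1 := h.map_mul_le (t := |a| / |b|) (by positivity) ((div_le_one hb').2 hab) |b|
  rw [div_mul_cancel₀ _ hb'.ne', h.map_abs, h.map_abs] at h1
  exact h1.trans (mul_le_of_le_one_left (h.nonneg b) ((div_le_one hb').2 hab))

theorem measurable (h : YoungClass p q Ψ) : Measurable Ψ := h.differentiable.continuous.measurable

/-- The derivative is `s^(-p-1) (s Ψ'(s) - p Ψ(s))`, nonpositive by the upper index bound. This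
yields the doubling property `map_mul_le_rpow`. -/
theorem antitoneOn_mul_rpow (h : YoungClass p q Ψ) :
    AntitoneOn (fun s => Ψ s * s ^ (-p)) (Set.Ioi 0) := by
  have hd : ∀ s : ℝ, 0 < s → HasDerivAt (fun s => Ψ s * s ^ (-p))
      (deriv Ψ s * s ^ (-p) + Ψ s * (-p * s ^ (-p - 1))) s := fun s hs =>
    (h.differentiable s).hasDerivAt.mul (Real.hasDerivAt_rpow_const (Or.inl hs.ne'))
  refine antitoneOn_of_deriv_nonpos (convex_Ioi 0)
    (fun s hs => (hd s hs).continuousAt.continuousWithinAt) ?_ ?_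
  · intro s hs
    rw [interior_Ioi] at hs
    exact (hd s hs).differentiableAt.differentiableWithinAt
  · intro s hs
    rw [interior_Ioi] at hs
    have hs0 : 0 < s := hs
    rw [(hd s hs).deriv]
    have h1 := h.upper s hs0.ne'
    rw [div_le_iff₀ (h.pos s hs0.ne')] at h1
    have h2 : s ^ (-p) = s ^ (-p - 1) * s := by
      rw [← Real.rpow_add_one hs0.ne']; ring_nf
    have h3 : 0 < s ^ (-p - 1) := Real.rpow_pos_of_pos hs0 _
    rw [h2]
    nlinarith

theorem map_mul_le_rpow (h : YoungClass p q Ψ) {l : ℝ} (hl : 1 ≤ l) (s : ℝ) :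
    Ψ (l * s) ≤ l ^ p * Ψ s := by
  rcases eq_or_ne s 0 with rfl | hs
  · simp [h.map_zero]
  have hl0 : 0 < l := by linarith
  have hs' : 0 < |s| := abs_pos.2 hs
  have h1 := h.antitoneOn_mul_rpow (Set.mem_Ioi.2 hs') (Set.mem_Ioi.2 (mul_pos hl0 hs'))
    (le_mul_of_one_le_left hs'.le hl)
  simp only [] at h1
  rw [Real.mul_rpow hl0.le hs'.le, ← mul_assoc] at h1
  have h2 := le_of_mul_le_mul_right h1 (Real.rpow_pos_of_pos hs' _)
  rw [Real.rpow_neg hl0.le, ← div_eq_mul_inv, div_le_iff₀ (Real.rpow_pos_of_pos hl0 _)] at h2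
  rw [← h.map_abs (l * s), ← h.map_abs s, abs_mul, abs_of_pos hl0]
  linarith

theorem le_rpow_mul_sub (h : YoungClass p q Ψ) {a b : ℝ} (hab : |b| ≤ |a| / 2) :
    Ψ a ≤ 2 ^ p * Ψ (a - b) := by
  refine (h.mono (b := 2 * (a - b)) ?_).trans (h.map_mul_le_rpow one_le_two _)
  rw [abs_mul, abs_two]
  have := abs_sub_abs_le_abs_sub a b
  linarith

theorem map_sub_div_le (h : YoungClass p q Ψ) {k : ℝ} (hk : 0 < k) (a b : ℝ) :
    Ψ ((a - b) / k) ≤ (max 1 (2 / k)) ^ p * (Ψ a + Ψ b) := by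
  set l := max 1 (2 / k) with hl
  have hl1 : 1 ≤ l := le_max_left _ _
  have hlk : 2 / k ≤ l := le_max_right _ _
  have hp : 0 ≤ l ^ p := Real.rpow_nonneg (by linarith) _
  have key : ∀ c : ℝ, |a| ≤ |c| → |b| ≤ |c| → Ψ ((a - b) / k) ≤ l ^ p * Ψ c := by
    intro c ha hb
    refine (h.mono ?_).trans (h.map_mul_le_rpow hl1 c)
    rw [abs_div, abs_mul, abs_of_pos hk, abs_of_pos (by linarith : (0 : ℝ) < l)]
    calc |a - b| / k ≤ (2 * |c|) / k := by
          gcongr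
          exact (abs_sub a b).trans (by linarith)
      _ = 2 / k * |c| := by ring
      _ ≤ l * |c| := by gcongr
  rcases le_total |a| |b| with hab | hab
  · exact (key b hab le_rfl).trans
      (mul_le_mul_of_nonneg_left (by linarith [h.nonneg a]) hp)
  · exact (key a le_rfl hab).trans
      (mul_le_mul_of_nonneg_left (by linarith [h.nonneg b]) hp)

/-- Superlinearity of convex functions, in the form of a linear bound. -/
theorem abs_le (h : YoungClass p q Ψ) {ε : ℝ} (hε : 0 < ε) (s : ℝ) :
    |s| ≤ ε + ε / Ψ ε * Ψ s := by
  have hΨ := h.pos ε hε.ne'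
  rcases le_total |s| ε with hs | hs
  · have : 0 ≤ ε / Ψ ε * Ψ s := mul_nonneg (by positivity) (h.nonneg s)
    linarith
  · have hs0 : 0 < |s| := hε.trans_le hs
    have h1 := h.map_mul_le (t := ε / |s|) (by positivity) ((div_le_one hs0).2 hs) |s|
    rw [div_mul_cancel₀ _ hs0.ne', h.map_abs] at h1
    have : |s| ≤ ε / Ψ ε * Ψ s := by
      rw [div_mul_eq_mul_div, le_div_iff₀ hΨ]
      rw [div_mul_eq_mul_div, le_div_iff₀ hs0] at h1
      linarith
    linarith

end YoungClass

/-! ### Gain of integrability from the energy. -/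

section Gain

variable {N : ℕ} {J : Space N → ℝ} {p q : ℝ} {Ψ : ℝ → ℝ}

/-- The density `∫ Ψ(u(x) - u(y)) J(x - y) dy` of the energy. -/
noncomputable def energyDensity (J : Space N → ℝ) (Ψ : ℝ → ℝ) (u : Space N → ℝ) (x : Space N) :
    ℝ≥0∞ :=
  ∫⁻ y : Space N, ENNReal.ofReal (Ψ (u x - u y) * J (x - y))

theorem lintegral_energyDensity (J : Space N → ℝ) (Ψ : ℝ → ℝ) (u : Space N → ℝ) :
    ∫⁻ x, energyDensity J Ψ u x = 2 * energy J Ψ u := by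
  unfold energy energyDensity
  rw [← mul_assoc, one_div, ENNReal.mul_inv_cancel (by simp) (by simp), one_mul]

/-- Integrating `Ψ(u(x) - u(y))` over a set close to `x` is controlled by the energy density. -/
theorem setLIntegral_le_energyDensity (hN : 0 < N) (hΨ : YoungClass p q Ψ) {α c δ : ℝ}
    (hα : 0 ≤ α) (hc : 0 < c)
    (hJ : ∀ z : Space N, 0 < ‖z‖ → ‖z‖ < 1 → c * ‖z‖ ^ (-(N : ℝ) - α) ≤ J z)
    (hδ0 : 0 < δ) (hδ1 : δ ≤ 1) (u : Space N → ℝ) (x : Space N) {S : Set (Space N)}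
    (hS : NullMeasurableSet S) (hSb : S ⊆ Metric.ball x δ) :
    ENNReal.ofReal (c * δ ^ (-(N : ℝ) - α)) * ∫⁻ y in S, ENNReal.ofReal (Ψ (u x - u y))
      ≤ energyDensity J Ψ u x := by
  -- In positive dimension points are null, so `y = x`, where `J` is not bounded below, may be
  -- discarded.
  have : Nonempty (Fin N) := ⟨⟨0, hN⟩⟩
  rw [← lintegral_const_mul' _ _ ENNReal.ofReal_ne_top, ← lintegral_indicator₀ hS]
  refine lintegral_mono_ae ?_
  have hx : ∀ᵐ y : Space N, y ≠ x := by
    simp [ae_iff]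
  filter_upwards [hx] with y hy
  by_cases hyS : y ∈ S
  · rw [Set.indicator_of_mem hyS, ← ENNReal.ofReal_mul (by positivity), mul_comm]
    refine ENNReal.ofReal_le_ofReal (mul_le_mul_of_nonneg_left ?_ (hΨ.nonneg _))
    have hlt : ‖x - y‖ < δ := by
      have := hSb hyS
      rwa [Metric.mem_ball, dist_comm, dist_eq_norm] at this
    have hpos : 0 < ‖x - y‖ := norm_pos_iff.2 (sub_ne_zero.2 hy.symm)
    refine le_trans ?_ (hJ (x - y) hpos (hlt.trans_le hδ1))
    have hN' : (0 : ℝ) ≤ N := N.cast_nonneg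
    exact mul_le_mul_of_nonneg_left
      (Real.rpow_le_rpow_of_nonpos hpos hlt.le (by linarith)) hc.le
  · simp [Set.indicator_of_notMem hyS]

/-- At least half of the ball consists of `y` with `|u y| ≤ |u x| / 2`, where `Ψ(u x - u y) ≥ 2^(-p)
Ψ(u x)`. The ball's volume `~ δ^N` against the kernel bound `δ^(-N-α)` leaves `δ^(-α)`. -/
theorem ofReal_mul_rpow_le_energyDensity (hN : 0 < N) (hΨ : YoungClass p q Ψ) {α c δ : ℝ}
    (hα : 0 ≤ α) (hc : 0 < c)
    (hJ : ∀ z : Space N, 0 < ‖z‖ → ‖z‖ < 1 → c * ‖z‖ ^ (-(N : ℝ) - α) ≤ J z)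
    (hδ0 : 0 < δ) (hδ1 : δ ≤ 1) {u : Space N → ℝ} (hu : AEMeasurable u) (x : Space N)
    (hH : volume {y | |u x| / 2 < |u y|} ≤ volume (Metric.ball x δ) / 2) :
    ENNReal.ofReal (c * (volume (Metric.ball (0 : Space N) 1)).toReal / 2 / 2 ^ p
      * (Ψ (u x) * δ ^ (-α))) ≤ energyDensity J Ψ u x := by
  set H := {y | |u x| / 2 < |u y|} with hHdef
  have hHm : NullMeasurableSet H :=
    nullMeasurableSet_lt aemeasurable_const (by fun_prop)
  set S := Metric.ball x δ \ H with hSdef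
  have hS : NullMeasurableSet S := measurableSet_ball.nullMeasurableSet.diff hHm
  have hle := setLIntegral_le_energyDensity hN hΨ hα hc hJ hδ0 hδ1 u x hS Set.sdiff_subset
  refine le_trans ?_ hle
  have hB : volume (Metric.ball x δ) ≠ ∞ := measure_ball_lt_top.ne
  have hvol : volume (Metric.ball x δ) / 2 ≤ volume S := by
    have h1 : volume (Metric.ball x δ) ≤ volume S + volume H := by
      refine (measure_mono ?_).trans (measure_union_le _ _)
      intro y hy
      by_cases hyH : y ∈ H
      · exact Or.inr hyH
      · exact Or.inl ⟨hy, hyH⟩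
    have h2 : volume (Metric.ball x δ) / 2 + volume (Metric.ball x δ) / 2
        ≤ volume S + volume (Metric.ball x δ) / 2 := by
      rw [ENNReal.add_halves]
      exact h1.trans (by gcongr)
    exact (ENNReal.add_le_add_iff_right (ENNReal.div_ne_top hB (by simp))).1 h2
  have hint : ENNReal.ofReal (Ψ (u x) / 2 ^ p) * volume S
      ≤ ∫⁻ y in S, ENNReal.ofReal (Ψ (u x - u y)) := by
    rw [← setLIntegral_const]
    rw [← lintegral_indicator₀ hS, ← lintegral_indicator₀ hS]
    refine lintegral_mono fun y => Set.indicator_le_indicator' fun hy => ?_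
    refine ENNReal.ofReal_le_ofReal ?_
    rw [div_le_iff₀' (by positivity)]
    exact hΨ.le_rpow_mul_sub (not_lt.1 hy.2)
  have hball : volume (Metric.ball x δ)
      = ENNReal.ofReal (δ ^ N * (volume (Metric.ball (0 : Space N) 1)).toReal) := by
    rw [Measure.addHaar_ball_of_pos _ _ hδ0, finrank_euclideanSpace_fin,
      ENNReal.ofReal_mul (by positivity), ENNReal.ofReal_toReal measure_ball_lt_top.ne]
  set ω := (volume (Metric.ball (0 : Space N) 1)).toReal with hω
  have hω0 : 0 ≤ ω := ENNReal.toReal_nonneg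
  calc ENNReal.ofReal (c * ω / 2 / 2 ^ p * (Ψ (u x) * δ ^ (-α)))
      = ENNReal.ofReal (c * δ ^ (-(N : ℝ) - α)) *
        (ENNReal.ofReal (Ψ (u x) / 2 ^ p) * (volume (Metric.ball x δ) / 2)) := by
        have h2 : ENNReal.ofReal (δ ^ N * ω) / 2 = ENNReal.ofReal (δ ^ N * ω / 2) := by
          rw [ENNReal.ofReal_div_of_pos two_pos]; simp
        have h3 : δ ^ (-(N : ℝ) - α) * δ ^ N = δ ^ (-α) := by
          rw [← Real.rpow_natCast δ N, ← Real.rpow_add hδ0]; ring_nf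
        rw [hball, h2, ← ENNReal.ofReal_mul (div_nonneg (hΨ.nonneg _) (by positivity)),
          ← ENNReal.ofReal_mul (by positivity), ← h3]
        congr 1
        ring
    _ ≤ _ := by gcongr; exact (mul_le_mul_right hvol _).trans hint

/-- Gain of integrability: a bound on `∫ Ψ(u)^s` improves to a bound on `∫ Ψ(u)^(1 + α s / N)`. -/
theorem exists_lintegral_rpow_le_of_lintegral_rpow_le (hN : 0 < N) (hΨ : YoungClass p q Ψ) {α : ℝ}
    (hα : 0 < α) (hJ : PowerLowerBound J α) {s : ℝ} (hs : 0 < s) (A C : ℝ≥0) :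
    ∃ C' : ℝ≥0, ∀ u : Space N → ℝ, AEMeasurable u → modular Ψ volume u ≤ A → energy J Ψ u ≤ A →
      ∫⁻ x, ENNReal.ofReal (Ψ (u x) ^ s) ≤ C →
      ∫⁻ x, ENNReal.ofReal (Ψ (u x) ^ (1 + α / N * s)) ≤ C' := by
  obtain ⟨c, hc, hJ⟩ := hJ
  set ω := (volume (Metric.ball (0 : Space N) 1)).toReal with hω
  have hω0 : 0 < ω := ENNReal.toReal_pos (Metric.measure_ball_pos _ _ one_pos).ne'
    measure_ball_lt_top.ne
  have hNr : (0 : ℝ) < N := Nat.cast_pos.2 hN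
  -- With `δ^N = B / b^s`, half the ball has volume `(C + 1) (2^p / b)^s`, just above the Chebyshev
  -- bound; `C + 1` keeps `B` positive when `C = 0`.
  set B : ℝ := 2 * (C + 1) * (2 ^ p) ^ s / ω with hB
  have hB0 : 0 < B := by positivity
  have h2p : (0 : ℝ) < 2 ^ p := by positivity
  set κ : ℝ := c * ω / 2 / 2 ^ p * B ^ (-(α / N)) with hκ
  have hκ0 : 0 < κ := by positivity
  have key : ∀ u : Space N → ℝ, AEMeasurable u → ∫⁻ x, ENNReal.ofReal (Ψ (u x) ^ s) ≤ C →
      ∀ x, ENNReal.ofReal (Ψ (u x) ^ (1 + α / N * s)) ≤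
        ENNReal.ofReal (B ^ (α / N)) * ENNReal.ofReal (Ψ (u x))
          + ENNReal.ofReal κ⁻¹ * energyDensity J Ψ u x := by
    intro u hu hC x
    rcases (hΨ.nonneg (u x)).eq_or_lt with hb | hb
    · rw [← hb, Real.zero_rpow (by positivity)]; simp
    set b := Ψ (u x) with hbdef
    have hbs : 0 < b ^ s := Real.rpow_pos_of_pos hb s
    have hpow : b ^ (1 + α / N * s) = b * (b ^ s) ^ (α / N) := by
      rw [Real.rpow_add hb, Real.rpow_one, ← Real.rpow_mul hb.le, mul_comm s]
    -- Small values of `b` are absorbed by the modular term; for large ones `δ ≤ 1`, so the kernel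
    -- bound is available.
    rcases le_total (b ^ s) B with hsmall | hlarge
    · refine le_trans ?_ le_self_add
      rw [← ENNReal.ofReal_mul (by positivity), hpow, mul_comm]
      refine ENNReal.ofReal_le_ofReal (mul_le_mul_of_nonneg_right ?_ hb.le)
      exact Real.rpow_le_rpow hbs.le hsmall (by positivity)
    · refine le_trans ?_ le_add_self
      set δ : ℝ := (B / b ^ s) ^ (1 / (N : ℝ)) with hδ
      have hδ0 : 0 < δ := by positivity
      have hδ1 : δ ≤ 1 :=
        Real.rpow_le_one (by positivity) ((div_le_one hbs).2 hlarge) (by positivity)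
      have hδN : δ ^ N = B / b ^ s := by
        rw [hδ, ← Real.rpow_natCast, ← Real.rpow_mul (by positivity), one_div,
          inv_mul_cancel₀ hNr.ne', Real.rpow_one]
      have hδα : δ ^ (-α) = B ^ (-(α / N)) * (b ^ s) ^ (α / N) := by
        rw [hδ, ← Real.rpow_mul (by positivity), Real.div_rpow hB0.le hbs.le]
        rw [show 1 / (N : ℝ) * -α = -(α / N) by ring, Real.rpow_neg hbs.le, div_inv_eq_mul]
      have hH : volume {y | |u x| / 2 < |u y|} ≤ volume (Metric.ball x δ) / 2 := by
        have h1 : volume {y | |u x| / 2 < |u y|} ≤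
            volume {y | ENNReal.ofReal ((b / 2 ^ p) ^ s) ≤ ENNReal.ofReal (Ψ (u y) ^ s)} := by
          refine measure_mono fun y hy => ?_
          refine ENNReal.ofReal_le_ofReal (Real.rpow_le_rpow (by positivity) ?_ hs.le)
          rw [div_le_iff₀' h2p]
          refine (hΨ.mono (b := 2 * u y) ?_).trans (hΨ.map_mul_le_rpow one_le_two _)
          rw [abs_mul, abs_two]
          have : |u x| / 2 < |u y| := hy
          linarith
        have hm : AEMeasurable (fun y => ENNReal.ofReal (Ψ (u y) ^ s)) :=
          ((hΨ.measurable.comp_aemeasurable hu).pow_const s).ennreal_ofReal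
        have hq0 : 0 < (b / 2 ^ p) ^ s := by positivity
        have h2 := mul_meas_ge_le_lintegral₀ hm (ENNReal.ofReal ((b / 2 ^ p) ^ s))
        have h3 : volume {y | ENNReal.ofReal ((b / 2 ^ p) ^ s) ≤ ENNReal.ofReal (Ψ (u y) ^ s)}
            ≤ C / ENNReal.ofReal ((b / 2 ^ p) ^ s) := by
          rw [ENNReal.le_div_iff_mul_le (Or.inl (by simpa using hq0)) (Or.inl (by simp)), mul_comm]
          exact h2.trans hC
        refine h1.trans (h3.trans ?_)
        rw [Measure.addHaar_ball_of_pos _ _ hδ0, finrank_euclideanSpace_fin,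
          ← ENNReal.ofReal_toReal (measure_ball_lt_top (x := (0 : Space N)) (r := 1)).ne,
          ← hω, ← ENNReal.ofReal_mul (by positivity), hδN, ← ENNReal.ofReal_coe_nnreal,
          ← ENNReal.ofReal_div_of_pos hq0, ← ENNReal.ofReal_ofNat 2,
          ← ENNReal.ofReal_div_of_pos two_pos]
        refine ENNReal.ofReal_le_ofReal ?_
        rw [Real.div_rpow hb.le h2p.le, hB]
        have h2ps : (0 : ℝ) < (2 ^ p) ^ s := by positivity
        rw [show 2 * ((C : ℝ) + 1) * (2 ^ p) ^ s / ω / b ^ s * ω / 2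
          = ((C : ℝ) + 1) / (b ^ s / (2 ^ p) ^ s) by field_simp]
        gcongr
        linarith
      have h4 := ofReal_mul_rpow_le_energyDensity hN hΨ hα.le hc hJ hδ0 hδ1 hu x hH
      calc ENNReal.ofReal (b ^ (1 + α / N * s))
          = ENNReal.ofReal κ⁻¹ * ENNReal.ofReal (c * ω / 2 / 2 ^ p * (b * δ ^ (-α))) := by
            rw [← ENNReal.ofReal_mul (by positivity), hδα, hpow]
            congr 1
            rw [show c * ω / 2 / 2 ^ p * (b * (B ^ (-(α / N)) * (b ^ s) ^ (α / N)))
              = κ * (b * (b ^ s) ^ (α / N)) by rw [hκ]; ring, inv_mul_cancel_left₀ hκ0.ne']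
        _ ≤ _ := by gcongr
  refine ⟨(B ^ (α / N)).toNNReal * A + κ⁻¹.toNNReal * (2 * A), fun u hu hA hE hC => ?_⟩
  have hm : AEMeasurable (fun y => ENNReal.ofReal (Ψ (u y))) :=
    (hΨ.measurable.comp_aemeasurable hu).ennreal_ofReal
  calc _ ≤ ∫⁻ x, (ENNReal.ofReal (B ^ (α / N)) * ENNReal.ofReal (Ψ (u x))
          + ENNReal.ofReal κ⁻¹ * energyDensity J Ψ u x) := lintegral_mono (key u hu hC)
    _ = ENNReal.ofReal (B ^ (α / N)) * modular Ψ volume u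
          + ENNReal.ofReal κ⁻¹ * (2 * energy J Ψ u) := by
        rw [lintegral_add_left' (hm.const_mul _), lintegral_const_mul' _ _ ENNReal.ofReal_ne_top,
          lintegral_const_mul' _ _ ENNReal.ofReal_ne_top, lintegral_energyDensity, modular]
    _ ≤ _ := by
        push_cast
        simp only [ENNReal.ofReal]
        gcongr

/-- Each gain step turns a partial geometric sum `S` into `1 + (α/N) S`, the next one. -/
theorem exists_lintegral_geom_rpow_le (hN : 0 < N) (hΨ : YoungClass p q Ψ) {α : ℝ}
    (hα : 0 < α) (hJ : PowerLowerBound J α) (A : ℝ≥0) (n : ℕ) :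
    ∃ C : ℝ≥0, ∀ u : Space N → ℝ, AEMeasurable u → modular Ψ volume u ≤ A → energy J Ψ u ≤ A →
      ∫⁻ x, ENNReal.ofReal (Ψ (u x) ^ (∑ i ∈ Finset.range (n + 1), (α / N) ^ i)) ≤ C := by
  have hNr : (0 : ℝ) < N := Nat.cast_pos.2 hN
  induction n with
  | zero => exact ⟨A, fun u _ h _ => by simpa [modular] using h⟩
  | succ n ih =>
    obtain ⟨C, hC⟩ := ih
    have hs : 0 < ∑ i ∈ Finset.range (n + 1), (α / N) ^ i :=
      Finset.sum_pos (fun i _ => by positivity) ⟨0, by simp⟩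
    obtain ⟨C', hC'⟩ := exists_lintegral_rpow_le_of_lintegral_rpow_le hN hΨ hα hJ hs A C
    refine ⟨C', fun u hu hA hE => ?_⟩
    have := hC' u hu hA hE (hC u hu hA hE)
    rwa [Finset.sum_range_succ', pow_zero, add_comm, Finset.sum_congr rfl
      (fun i _ => pow_succ' (α / (N : ℝ)) i), ← Finset.mul_sum]

theorem exists_lt_geom_sum {θ r : ℝ} (hθ : 0 < θ) (hr : θ < 1 → r < (1 - θ)⁻¹) :
    ∃ n : ℕ, r < ∑ i ∈ Finset.range (n + 1), θ ^ i := by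
  rcases lt_or_ge θ 1 with h1 | h1
  · have := (hasSum_geometric_of_lt_one hθ.le h1).tendsto_sum_nat
    exact ((tendsto_add_atTop_iff_nat 1).2 this |>.eventually_const_lt (hr h1)).exists
  · obtain ⟨n, hn⟩ := exists_nat_gt r
    refine ⟨n, hn.trans_le ?_⟩
    calc (n : ℝ) ≤ ∑ i ∈ Finset.range (n + 1), (1 : ℝ) := by simp
      _ ≤ _ := Finset.sum_le_sum fun i _ => one_le_pow₀ h1

/-- Uniform bound for `∫ Ψ(u)^s` in the whole subcritical range. -/
theorem exists_lintegral_rpow_le (hN : 0 < N) (hΨ : YoungClass p q Ψ) {α : ℝ}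
    (hα : 0 < α) (hJ : PowerLowerBound J α) {r : ℝ}
    (hrα : α < (N : ℝ) → r < (N : ℝ) / ((N : ℝ) - α)) :
    ∃ s : ℝ, r < s ∧ ∀ t : ℝ, 1 ≤ t → t ≤ s → ∀ A : ℝ≥0, ∃ C : ℝ≥0, ∀ u : Space N → ℝ,
      AEMeasurable u → modular Ψ volume u ≤ A → energy J Ψ u ≤ A →
      ∫⁻ x, ENNReal.ofReal (Ψ (u x) ^ t) ≤ C := by
  have hNr : (0 : ℝ) < N := Nat.cast_pos.2 hN
  obtain ⟨n, hn⟩ := exists_lt_geom_sum (θ := α / N) (r := r) (by positivity) (by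
    intro h
    rw [div_lt_one hNr] at h
    have h' : (0 : ℝ) < N - α := by linarith
    rw [show (1 - α / (N : ℝ))⁻¹ = N / (N - α) by field_simp]
    exact hrα h)
  refine ⟨_, hn, fun t ht1 hts A => ?_⟩
  obtain ⟨C, hC⟩ := exists_lintegral_geom_rpow_le hN hΨ hα hJ A n
  refine ⟨A + C, fun u hu hA hE => ?_⟩
  have hm : AEMeasurable (fun y => ENNReal.ofReal (Ψ (u y))) :=
    (hΨ.measurable.comp_aemeasurable hu).ennreal_ofReal
  have := hC u hu hA hE
  set s := ∑ i ∈ Finset.range (n + 1), (α / (N : ℝ)) ^ i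
  -- Interpolation between the exponents `1` and `s`: `a^t ≤ a` for `a ≤ 1` and `a^t ≤ a^s` for `a ≥
  -- 1`.
  calc ∫⁻ x, ENNReal.ofReal (Ψ (u x) ^ t)
      ≤ ∫⁻ x, (ENNReal.ofReal (Ψ (u x)) + ENNReal.ofReal (Ψ (u x) ^ s)) := by
        refine lintegral_mono fun x => ?_
        rcases (hΨ.nonneg (u x)).eq_or_lt with h0 | h0
        · rw [← h0, Real.zero_rpow (by linarith)]; simp
        rcases le_total (Ψ (u x)) 1 with h1 | h1
        · refine le_trans (ENNReal.ofReal_le_ofReal ?_) le_self_add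
          simpa using Real.rpow_le_rpow_of_exponent_ge h0 h1 ht1
        · refine le_trans (ENNReal.ofReal_le_ofReal ?_) le_add_self
          exact Real.rpow_le_rpow_of_exponent_le h1 hts
    _ = _ := lintegral_add_left' hm _
    _ ≤ A + C := add_le_add hA this

end Gain

end NonlocalOrlicz

namespace NonlocalOrlicz

/-! ### Partition into small cubes. -/

section Cells

variable {N : ℕ}

/-- The index of the cube of side `1 / (m + 1)` containing `x`. -/
noncomputable def cellIndex (m : ℕ) (x : Space N) : Fin N → ℤ := fun i => ⌊x i * (m + 1)⌋

theorem measurable_cellIndex (m : ℕ) : Measurable (cellIndex (N := N) m) := by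
  refine measurable_pi_lambda _ fun i => Int.measurable_floor.comp ?_
  fun_prop

/-- The cube of side `1 / (m + 1)` with index `k`. -/
def cell (m : ℕ) (k : Fin N → ℤ) : Set (Space N) := cellIndex m ⁻¹' {k}

theorem measurableSet_cell (m : ℕ) (k : Fin N → ℤ) : MeasurableSet (cell m k) :=
  measurable_cellIndex m (measurableSet_singleton k)

theorem volume_cell (m : ℕ) (k : Fin N → ℤ) :
    volume (cell m k) = ENNReal.ofReal ((((m : ℝ) + 1) ^ N)⁻¹) := by
  have hm : (0 : ℝ) < m + 1 := by positivity
  have h : cell m k = WithLp.ofLp ⁻¹' (Set.univ.pi fun i =>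
      Set.Ico ((k i : ℝ) / (m + 1)) (((k i : ℝ) + 1) / (m + 1))) := by
    ext x
    simp only [cell, cellIndex, Set.mem_preimage, Set.mem_singleton_iff, Set.mem_univ_pi,
      Set.mem_Ico, funext_iff, Int.floor_eq_iff, div_le_iff₀ hm, lt_div_iff₀ hm]
  rw [h, (PiLp.volume_preserving_ofLp (Fin N)).measure_preimage
    (MeasurableSet.univ_pi fun i => measurableSet_Ico).nullMeasurableSet, Real.volume_pi_Ico]
  have : ∀ i, ((k i : ℝ) + 1) / (m + 1) - (k i : ℝ) / (m + 1) = ((m : ℝ) + 1)⁻¹ := fun i => by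
    field_simp; ring
  simp [this, ENNReal.ofReal_pow (inv_nonneg.2 hm.le), ← inv_pow]

/-- The diameter is at most `√N / (m + 1)`; replacing `√N` by `N + 1` avoids the root and makes the
inequality strict. -/
theorem cell_subset_ball (m : ℕ) (x : Space N) :
    cell m (cellIndex m x) ⊆ Metric.ball x (((N : ℝ) + 1) / (m + 1)) := by
  intro y hy
  have hm : (0 : ℝ) < m + 1 := by positivity
  have hi : ∀ i, ‖(y - x) i‖ ≤ 1 / ((m : ℝ) + 1) := by
    intro i
    have h1 : ⌊y i * (m + 1)⌋ = ⌊x i * (m + 1)⌋ := congrFun (hy : cellIndex m y = cellIndex m x) i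
    have h2 := Int.abs_sub_lt_one_of_floor_eq_floor h1
    rw [← sub_mul, abs_mul, abs_of_pos hm, ← lt_div_iff₀ hm] at h2
    simpa using h2.le
  have hsum : ‖y - x‖ ^ 2 ≤ ((N : ℝ)) * (1 / ((m : ℝ) + 1)) ^ 2 := by
    rw [EuclideanSpace.norm_sq_eq]
    calc ∑ i, ‖(y - x) i‖ ^ 2 ≤ ∑ _i : Fin N, (1 / ((m : ℝ) + 1)) ^ 2 :=
          Finset.sum_le_sum fun i _ => pow_le_pow_left₀ (norm_nonneg _) (hi i) 2
      _ = _ := by simp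
  rw [Metric.mem_ball, dist_eq_norm]
  refine lt_of_pow_lt_pow_left₀ 2 (by positivity) (hsum.trans_lt ?_)
  rw [div_eq_mul_one_div ((N : ℝ) + 1), mul_pow]
  refine mul_lt_mul_of_pos_right ?_ (by positivity)
  nlinarith [(N.cast_nonneg : (0 : ℝ) ≤ N)]

/-- The average of `u` over a cell. -/
noncomputable def cellAverage (u : Space N → ℝ) (m : ℕ) (k : Fin N → ℤ) : ℝ :=
  ((m : ℝ) + 1) ^ N * ∫ y in cell m k, u y

end Cells

/-! ### Compactness in `L¹` by cell averages. -/

section Compactness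

variable {N : ℕ} {J : Space N → ℝ} {p q : ℝ} {Ψ : ℝ → ℝ}

theorem YoungClass.enorm_le (hΨ : YoungClass p q Ψ) {ε : ℝ} (hε : 0 < ε) (s : ℝ) :
    ‖s‖ₑ ≤ ENNReal.ofReal ε + ENNReal.ofReal (ε / Ψ ε) * ENNReal.ofReal (Ψ s) := by
  have hΨε := hΨ.pos ε hε.ne'
  rw [← ENNReal.ofReal_mul (by positivity), ← ENNReal.ofReal_add hε.le
    (mul_nonneg (by positivity) (hΨ.nonneg s)), Real.enorm_eq_ofReal_abs]
  exact ENNReal.ofReal_le_ofReal (hΨ.abs_le hε s)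

theorem setLIntegral_enorm_le (hΨ : YoungClass p q Ψ) (u : Space N → ℝ) (S : Set (Space N)) :
    ∫⁻ x in S, ‖u x‖ₑ ≤ volume S + modular Ψ volume u := by
  calc ∫⁻ x in S, ‖u x‖ₑ ≤ ∫⁻ x in S, (1 + ENNReal.ofReal (Ψ (u x))) := by
        refine lintegral_mono fun x => ?_
        simpa [hΨ.map_one] using hΨ.enorm_le one_pos (u x)
    _ = volume S + ∫⁻ x in S, ENNReal.ofReal (Ψ (u x)) := by
        rw [lintegral_add_left measurable_const]; simp
    _ ≤ _ := by gcongr; exact setLIntegral_le_lintegral _ _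

theorem integrableOn_of_modular (hΨ : YoungClass p q Ψ) {u : Space N → ℝ} (hu : AEMeasurable u)
    (hM : modular Ψ volume u ≠ ∞) {S : Set (Space N)} (hS : volume S ≠ ∞) :
    IntegrableOn u S :=
  ⟨hu.restrict.aestronglyMeasurable, (setLIntegral_enorm_le hΨ u S).trans_lt
    (ENNReal.add_lt_top.2 ⟨hS.lt_top, hM.lt_top⟩)⟩

/-- The bound depends on `m` but not on `u` or `k`, which suffices for extracting a diagonal
subsequence. -/
theorem abs_cellAverage_le (hΨ : YoungClass p q Ψ) {A : ℝ≥0} {u : Space N → ℝ}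
    (hM : modular Ψ volume u ≤ A) (m : ℕ) (k : Fin N → ℤ) :
    |cellAverage u m k| ≤ ((m : ℝ) + 1) ^ N * ((((m : ℝ) + 1) ^ N)⁻¹ + A) := by
  rw [cellAverage, abs_mul, abs_of_pos (by positivity)]
  gcongr
  have h := (enorm_integral_le_lintegral_enorm (μ := volume.restrict (cell m k)) u).trans
    ((setLIntegral_enorm_le hΨ u _).trans (add_le_add_right hM _))
  rw [volume_cell, ← ENNReal.ofReal_coe_nnreal, ← ENNReal.ofReal_add (by positivity) A.coe_nonneg,
    Real.enorm_eq_ofReal_abs] at h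
  exact (ENNReal.ofReal_le_ofReal_iff (by positivity)).1 h

/-- The left side is the average of `u x - u y` over the cell. The linear bound of `|·|` by `ε` and
`Ψ` brings in the energy density; the normalisation `(m + 1)^N` cancels against `δ^N`, `δ = (N + 1)
/ (m + 1)`, and the factor `δ^α` survives. -/
theorem enorm_sub_cellAverage_le (hN : 0 < N) (hΨ : YoungClass p q Ψ) {α c : ℝ}
    (hα : 0 ≤ α) (hc : 0 < c)
    (hJ : ∀ z : Space N, 0 < ‖z‖ → ‖z‖ < 1 → c * ‖z‖ ^ (-(N : ℝ) - α) ≤ J z)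
    {u : Space N → ℝ} (hu : AEMeasurable u) (hM : modular Ψ volume u ≠ ∞) {m : ℕ} (hm : N ≤ m)
    {ε : ℝ} (hε : 0 < ε) (x : Space N) :
    ‖u x - cellAverage u m (cellIndex m x)‖ₑ ≤ ENNReal.ofReal ε +
      ENNReal.ofReal (ε / Ψ ε * (((N : ℝ) + 1) ^ N / c * (((N : ℝ) + 1) / (m + 1)) ^ α))
        * energyDensity J Ψ u x := by
  set S := cell m (cellIndex m x) with hS
  set δ : ℝ := ((N : ℝ) + 1) / (m + 1) with hδ
  have hm0 : (0 : ℝ) < m + 1 := by positivity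
  have hδ0 : 0 < δ := by positivity
  have hδ1 : δ ≤ 1 := (div_le_one hm0).2 (by gcongr)
  have hΨε := hΨ.pos ε hε.ne'
  have hvol : volume S = ENNReal.ofReal ((((m : ℝ) + 1) ^ N)⁻¹) := volume_cell m _
  have hvol' : volume.real S = (((m : ℝ) + 1) ^ N)⁻¹ := by
    rw [measureReal_def, hvol, ENNReal.toReal_ofReal (by positivity)]
  have hfin : volume S ≠ ∞ := by rw [hvol]; exact ENNReal.ofReal_ne_top
  have hu' := integrableOn_of_modular hΨ hu hM hfin
  have heq : u x - cellAverage u m (cellIndex m x)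
      = ((m : ℝ) + 1) ^ N * ∫ y in S, (u x - u y) := by
    rw [integral_sub (integrable_const_iff.2 (Or.inr ⟨by simpa using hfin.lt_top⟩)) hu', setIntegral_const, hvol', cellAverage,
      mul_sub, smul_eq_mul, mul_inv_cancel_left₀ (by positivity)]
  have hG := setLIntegral_le_energyDensity hN hΨ hα hc hJ hδ0 hδ1 u x
    (measurableSet_cell m _).nullMeasurableSet (cell_subset_ball m x)
  rw [← hS] at hG
  have hcoef : ε / Ψ ε * (((N : ℝ) + 1) ^ N / c * δ ^ α) * (c * δ ^ (-(N : ℝ) - α))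
      = ((m : ℝ) + 1) ^ N * (ε / Ψ ε) := by
    have h1 : δ ^ α * δ ^ (-(N : ℝ) - α) = (δ ^ N)⁻¹ := by
      rw [← Real.rpow_add hδ0, show α + (-(N : ℝ) - α) = -N by ring, Real.rpow_neg hδ0.le,
        Real.rpow_natCast]
    calc _ = ε / Ψ ε * ((N : ℝ) + 1) ^ N * (δ ^ α * δ ^ (-(N : ℝ) - α)) * (c / c) := by ring
      _ = _ := by rw [h1, div_self hc.ne', hδ, div_pow]; field_simp
  calc ‖u x - cellAverage u m (cellIndex m x)‖ₑ
      = ENNReal.ofReal (((m : ℝ) + 1) ^ N) * ‖∫ y in S, (u x - u y)‖ₑ := by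
        rw [heq, enorm_mul, Real.enorm_eq_ofReal_abs (((m : ℝ) + 1) ^ N),
          abs_of_pos (by positivity)]
    _ ≤ ENNReal.ofReal (((m : ℝ) + 1) ^ N) * ∫⁻ y in S, (ENNReal.ofReal ε +
          ENNReal.ofReal (ε / Ψ ε) * ENNReal.ofReal (Ψ (u x - u y))) := by
        gcongr
        exact (enorm_integral_le_lintegral_enorm _).trans
          (lintegral_mono fun y => hΨ.enorm_le hε _)
    _ = ENNReal.ofReal ε + ENNReal.ofReal (((m : ℝ) + 1) ^ N * (ε / Ψ ε)) *
          ∫⁻ y in S, ENNReal.ofReal (Ψ (u x - u y)) := by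
        rw [lintegral_add_left measurable_const, lintegral_const_mul' _ _ ENNReal.ofReal_ne_top,
          setLIntegral_const, hvol, mul_add, ← mul_assoc, ← ENNReal.ofReal_mul (by positivity),
          ← ENNReal.ofReal_mul (by positivity), ← mul_assoc, ← ENNReal.ofReal_mul (by positivity),
          mul_right_comm, mul_inv_cancel₀ (by positivity), one_mul]
    _ ≤ _ := by
        rw [← hcoef, ENNReal.ofReal_mul (by positivity), mul_assoc]
        gcongr

/-- Uniform approximation in `L¹` by averages over small cells. -/
theorem eventually_lintegral_sub_cellAverage_le (hN : 0 < N) (hΨ : YoungClass p q Ψ) {α : ℝ}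
    (hα : 0 < α) (hJ : PowerLowerBound J α) {Ω : Set (Space N)} (hΩ : volume Ω ≠ ∞) (A : ℝ≥0)
    {η : ℝ≥0∞} (hη : 0 < η) :
    ∀ᶠ m : ℕ in atTop, ∀ u : Space N → ℝ, AEMeasurable u → modular Ψ volume u ≤ A →
      energy J Ψ u ≤ A → ∫⁻ x in Ω, ‖u x - cellAverage u m (cellIndex m x)‖ₑ ≤ η := by
  obtain ⟨c, hc, hJ⟩ := hJ
  -- `ε` is fixed before `m`: the factor `ε / Ψ ε` may be large, but it is constant as `m → ∞`.
  obtain ⟨ε, hε, hεη⟩ : ∃ ε : ℝ, 0 < ε ∧ ENNReal.ofReal ε * volume Ω < η := by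
    have h1 : Tendsto (fun ε : ℝ => ENNReal.ofReal ε * volume Ω) (𝓝[>] 0) (𝓝 0) := by
      have h2 : Tendsto (fun ε : ℝ => ENNReal.ofReal ε) (𝓝[>] 0) (𝓝 0) := by
        simpa using (ENNReal.continuous_ofReal.tendsto 0).mono_left nhdsWithin_le_nhds
      simpa using ENNReal.Tendsto.mul_const h2 (Or.inr hΩ)
    obtain ⟨ε, h2, h3⟩ := ((h1.eventually_lt_const hη).and self_mem_nhdsWithin).exists
    exact ⟨ε, h3, h2⟩
  have hlim : Tendsto (fun m : ℕ => ENNReal.ofReal ε * volume Ω + ENNReal.ofReal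
      (ε / Ψ ε * (((N : ℝ) + 1) ^ N / c * (((N : ℝ) + 1) / (m + 1)) ^ α)) * (2 * A)) atTop
      (𝓝 (ENNReal.ofReal ε * volume Ω + 0)) := by
    refine tendsto_const_nhds.add ?_
    have h1 : Tendsto (fun m : ℕ => ((N : ℝ) + 1) / (m + 1)) atTop (𝓝 0) :=
      tendsto_const_nhds.div_atTop
        (tendsto_atTop_add_const_right _ _ tendsto_natCast_atTop_atTop)
    have h2 : Tendsto (fun m : ℕ => (((N : ℝ) + 1) / (m + 1)) ^ α) atTop (𝓝 0) := by
      simpa [Real.zero_rpow hα.ne'] using h1.rpow_const (Or.inr hα.le)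
    have h3 := ENNReal.tendsto_ofReal ((h2.const_mul (((N : ℝ) + 1) ^ N / c)).const_mul (ε / Ψ ε))
    have h4 := ENNReal.Tendsto.mul_const (b := 2 * (A : ℝ≥0∞)) h3
      (Or.inr (ENNReal.mul_ne_top (by simp) (by simp)))
    simpa using h4
  rw [add_zero] at hlim
  filter_upwards [hlim.eventually_lt_const hεη, eventually_ge_atTop N] with m hm hNm u hu hM hE
  refine le_trans ?_ hm.le
  calc _ ≤ ∫⁻ x in Ω, (ENNReal.ofReal ε + ENNReal.ofReal
      (ε / Ψ ε * (((N : ℝ) + 1) ^ N / c * (((N : ℝ) + 1) / (m + 1)) ^ α))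
        * energyDensity J Ψ u x) := lintegral_mono fun x =>
          enorm_sub_cellAverage_le hN hΨ hα.le hc hJ hu (ne_top_of_le_ne_top (by simp) hM) hNm hε x
    _ ≤ _ := by
      rw [lintegral_add_left measurable_const, lintegral_const_mul' _ _ ENNReal.ofReal_ne_top,
        setLIntegral_const]
      gcongr
      calc ∫⁻ x in Ω, energyDensity J Ψ u x ≤ ∫⁻ x, energyDensity J Ψ u x :=
            setLIntegral_le_lintegral _ _
        _ = 2 * energy J Ψ u := lintegral_energyDensity J Ψ u
        _ ≤ _ := by gcongr

/-- A countable product of compact intervals is sequentially compact, so one subsequence serves all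
`m` and `k`. -/
theorem exists_subseq_tendsto_cellAverage (hΨ : YoungClass p q Ψ) (A : ℝ≥0)
    (u : ℕ → Space N → ℝ) (hM : ∀ n, modular Ψ volume (u n) ≤ A) :
    ∃ φ : ℕ → ℕ, StrictMono φ ∧ ∃ l : ℕ → (Fin N → ℤ) → ℝ,
      ∀ m k, Tendsto (fun n => cellAverage (u (φ n)) m k) atTop (𝓝 (l m k)) := by
  set R : ℕ → ℝ := fun m => ((m : ℝ) + 1) ^ N * ((((m : ℝ) + 1) ^ N)⁻¹ + A) with hR
  have hK : IsCompact (Set.univ.pi fun i : ℕ × (Fin N → ℤ) => Set.Icc (-R i.1) (R i.1)) :=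
    isCompact_univ_pi fun i => isCompact_Icc
  obtain ⟨l, -, φ, hφ, hl⟩ := hK.tendsto_subseq
    (x := fun n (i : ℕ × (Fin N → ℤ)) => cellAverage (u n) i.1 i.2)
    (fun n i _ => abs_le.1 (abs_cellAverage_le hΨ (hM n) i.1 i.2))
  exact ⟨φ, hφ, fun m k => l (m, k), fun m k => (tendsto_pi_nhds.1 hl) (m, k)⟩

theorem tendsto_lintegral_cellAverage_sub (hΨ : YoungClass p q Ψ) (A : ℝ≥0)
    (u : ℕ → Space N → ℝ) (hM : ∀ n, modular Ψ volume (u n) ≤ A) {m : ℕ} {l : (Fin N → ℤ) → ℝ}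
    (hl : ∀ k, Tendsto (fun n => cellAverage (u n) m k) atTop (𝓝 (l k)))
    {Ω : Set (Space N)} (hΩ : volume Ω ≠ ∞) :
    Tendsto (fun n => ∫⁻ x in Ω, ‖cellAverage (u n) m (cellIndex m x) - l (cellIndex m x)‖ₑ)
      atTop (𝓝 0) := by
  set R : ℝ := ((m : ℝ) + 1) ^ N * ((((m : ℝ) + 1) ^ N)⁻¹ + A) with hR
  have hb : ∀ n k, |cellAverage (u n) m k| ≤ R := fun n k => abs_cellAverage_le hΨ (hM n) m k
  have hlb : ∀ k, |l k| ≤ R := fun k => le_of_tendsto (hl k).abs (Eventually.of_forall fun n => hb n k)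
  have := tendsto_lintegral_of_dominated_convergence (μ := volume.restrict Ω) (f := fun _ => 0)
    (F := fun n x => ‖cellAverage (u n) m (cellIndex m x) - l (cellIndex m x)‖ₑ)
    (fun _ => ENNReal.ofReal (R + R)) (fun n => ?_) (fun n => ?_) ?_ ?_
  · simpa using this
  · exact (measurable_of_countable fun k => ‖cellAverage (u n) m k - l k‖ₑ).comp
      (measurable_cellIndex m)
  · refine Eventually.of_forall fun x => ?_
    simp only [Real.enorm_eq_ofReal_abs]
    exact ENNReal.ofReal_le_ofReal ((abs_sub _ _).trans (add_le_add (hb _ _) (hlb _)))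
  · simpa using ENNReal.mul_ne_top ENNReal.ofReal_ne_top hΩ
  · refine Eventually.of_forall fun x => ?_
    have := ((hl (cellIndex m x)).sub_const (l (cellIndex m x))).enorm
    simpa using this

/-- A sequence with bounded modular and energy has a subsequence converging almost everywhere on
any set of finite measure. -/
theorem exists_subseq_tendsto_ae (hN : 0 < N) (hΨ : YoungClass p q Ψ) {α : ℝ}
    (hα : 0 < α) (hJ : PowerLowerBound J α) {Ω : Set (Space N)} (hΩ : volume Ω ≠ ∞) (A : ℝ≥0)
    (u : ℕ → Space N → ℝ) (hu : ∀ n, AEMeasurable (u n)) (hM : ∀ n, modular Ψ volume (u n) ≤ A)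
    (hE : ∀ n, energy J Ψ (u n) ≤ A) :
    ∃ φ : ℕ → ℕ, StrictMono φ ∧ ∃ v : Space N → ℝ, AEMeasurable v (volume.restrict Ω) ∧
      ∀ᵐ x ∂volume.restrict Ω, Tendsto (fun n => u (φ n) x) atTop (𝓝 (v x)) := by
  obtain ⟨φ, hφ, l, hl⟩ := exists_subseq_tendsto_cellAverage hΨ A u hM
  have hLp : ∀ n, MemLp (u (φ n)) 1 (volume.restrict Ω) := fun n => memLp_one_iff_integrable.2
    (integrableOn_of_modular hΨ (hu _) (ne_top_of_le_ne_top (by simp) (hM _)) hΩ)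
  set f : ℕ → Lp ℝ 1 (volume.restrict Ω) := fun n => (hLp n).toLp with hf
  have hcauchy : CauchySeq f := by
    rw [EMetric.cauchySeq_iff]
    intro η hη
    obtain ⟨ε, hε, hεη⟩ := exists_between hη
    have hε4 : 0 < ε / 2 / 2 :=
      ENNReal.div_pos (ENNReal.div_pos hε.ne' (by simp)).ne' (by simp)
    obtain ⟨m, hm⟩ :=
      (eventually_lintegral_sub_cellAverage_le hN hΨ hα hJ hΩ A hε4).exists
    have ht := tendsto_lintegral_cellAverage_sub hΨ A (fun n => u (φ n)) (fun n => hM _) (hl m) hΩ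
    obtain ⟨n₀, hn₀⟩ := eventually_atTop.1 (ht.eventually_lt_const hε4)
    -- A single step function, for one fixed `m`, is within `ε / 2` of all late terms; different `m`
    -- need not be compared.
    have hclose : ∀ n, n₀ ≤ n →
        eLpNorm (u (φ n) - fun x => l m (cellIndex m x)) 1 (volume.restrict Ω) ≤ ε / 2 := by
      intro n hn
      rw [eLpNorm_one_eq_lintegral_enorm, ← ENNReal.add_halves (ε / 2)]
      have hmeas : Measurable fun x : Space N =>
          ‖cellAverage (u (φ n)) m (cellIndex m x) - l m (cellIndex m x)‖ₑ :=
        (measurable_of_countable fun k => ‖cellAverage (u (φ n)) m k - l m k‖ₑ).comp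
          (measurable_cellIndex m)
      calc _ ≤ ∫⁻ x in Ω, (‖u (φ n) x - cellAverage (u (φ n)) m (cellIndex m x)‖ₑ
            + ‖cellAverage (u (φ n)) m (cellIndex m x) - l m (cellIndex m x)‖ₑ) := by
            refine lintegral_mono fun x => ?_
            refine le_trans (le_of_eq ?_) (enorm_add_le _ _)
            simp
        _ ≤ _ := by
            rw [lintegral_add_right _ hmeas]
            exact add_le_add (hm _ (hu _) (hM _) (hE _)) (hn₀ n hn).le
    have hLm : AEStronglyMeasurable (fun x : Space N => l m (cellIndex m x))
        (volume.restrict Ω) :=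
      ((measurable_of_countable (l m)).comp (measurable_cellIndex m)).aestronglyMeasurable
    refine ⟨n₀, fun i hi j hj => ?_⟩
    rw [hf, Lp.edist_toLp_toLp]
    have h1 : u (φ i) - u (φ j) = (u (φ i) - fun x => l m (cellIndex m x))
        - (u (φ j) - fun x => l m (cellIndex m x)) := by ext x; simp
    rw [h1]
    refine (eLpNorm_sub_le ((hLp i).1.sub hLm) ((hLp j).1.sub hLm) le_rfl).trans_lt ?_
    refine (add_le_add (hclose i hi) (hclose j hj)).trans_lt ?_
    rwa [ENNReal.add_halves]
  obtain ⟨g, hg⟩ := cauchySeq_tendsto_of_complete hcauchy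
  obtain ⟨ψ, hψ, hae⟩ := (tendstoInMeasure_of_tendsto_Lp hg).exists_seq_tendsto_ae
  refine ⟨φ ∘ ψ, hφ.comp hψ, g, (Lp.aestronglyMeasurable g).aemeasurable, ?_⟩
  have hco : ∀ᵐ x ∂volume.restrict Ω, ∀ n, f n x = u (φ n) x :=
    ae_all_iff.2 fun n => (hLp n).coeFn_toLp
  filter_upwards [hae, hco] with x hx hx'
  simpa [hx'] using hx

end Compactness

end NonlocalOrlicz

namespace NonlocalOrlicz

/-! ### Passing between Luxemburg norms and modulars. -/

section Luxemburg

variable {X : Type*} {N : ℕ} {J : Space N → ℝ} {p q : ℝ} {Ψ : ℝ → ℝ}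

theorem luxemburg_le {M : (X → ℝ) → ℝ≥0∞} {u : X → ℝ} {k : ℝ} (hk : 0 < k)
    (h : M (fun x => u x / k) ≤ 1) : luxemburg M u ≤ ENNReal.ofReal k :=
  iInf_le_of_le k (iInf_le_of_le hk (iInf_le _ h))

theorem exists_of_luxemburg_lt {M : (X → ℝ) → ℝ≥0∞} {u : X → ℝ} {L : ℝ}
    (h : luxemburg M u < ENNReal.ofReal L) : ∃ k, 0 < k ∧ k ≤ L ∧ M (fun x => u x / k) ≤ 1 := by
  simp only [luxemburg, iInf_lt_iff] at h
  obtain ⟨k, hk, hM, hkL⟩ := h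
  exact ⟨k, hk, ((ENNReal.ofReal_lt_ofReal_iff_of_nonneg hk.le).1 hkL).le, hM⟩

theorem modular_mono [MeasurableSpace X] (hΨ : YoungClass p q Ψ) {μ : Measure X} {u v : X → ℝ}
    (h : ∀ x, |u x| ≤ |v x|) : modular Ψ μ u ≤ modular Ψ μ v :=
  lintegral_mono fun x => ENNReal.ofReal_le_ofReal (hΨ.mono (h x))

theorem energy_mono (hΨ : YoungClass p q Ψ) {u v : Space N → ℝ}
    (h : ∀ x y, |u x - u y| ≤ |v x - v y|) : energy J Ψ u ≤ energy J Ψ v := by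
  unfold energy
  refine mul_le_mul_right (lintegral_mono fun x => lintegral_mono fun y => ?_) _
  rw [ENNReal.ofReal_mul (hΨ.nonneg _), ENNReal.ofReal_mul (hΨ.nonneg _)]
  gcongr
  exact hΨ.mono (h x y)

/-- Strict inequality supplies an admissible `k ≤ L` for each summand without the infimum being
attained; dividing by the larger `L` only decreases both modulars. -/
theorem modular_energy_le_one_of_wNorm_lt (hΨ : YoungClass p q Ψ) {u : Space N → ℝ} {L : ℝ}
    (h : wNorm J Ψ u < ENNReal.ofReal L) :
    modular Ψ volume (fun x => u x / L) ≤ 1 ∧ energy J Ψ (fun x => u x / L) ≤ 1 := by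
  constructor
  · obtain ⟨k, hk, hkL, hM⟩ := exists_of_luxemburg_lt (lt_of_le_of_lt le_self_add h)
    refine (modular_mono hΨ fun x => ?_).trans hM
    rw [abs_div, abs_div, abs_of_pos hk, abs_of_pos (hk.trans_le hkL)]
    gcongr
  · obtain ⟨k, hk, hkL, hM⟩ := exists_of_luxemburg_lt (lt_of_le_of_lt le_add_self h)
    refine (energy_mono hΨ fun x y => ?_).trans hM
    rw [← sub_div, ← sub_div, abs_div, abs_div, abs_of_pos hk, abs_of_pos (hk.trans_le hkL)]
    gcongr

theorem tendsto_orliczNorm_zero [MeasurableSpace X] {Θ : ℝ → ℝ} {μ : Measure X} {u : ℕ → X → ℝ}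
    (h : ∀ k : ℝ, 0 < k → Tendsto (fun n => modular Θ μ (fun x => u n x / k)) atTop (𝓝 0)) :
    Tendsto (fun n => orliczNorm Θ μ (u n)) atTop (𝓝 0) := by
  rw [ENNReal.tendsto_nhds_zero]
  intro ε hε
  obtain ⟨k, hk, hkε⟩ := ENNReal.lt_iff_exists_nnreal_btwn.1 hε
  have hk' : (0 : ℝ) < k := by exact_mod_cast hk
  filter_upwards [(h k hk').eventually_le_const zero_lt_one] with n hn
  refine (luxemburg_le hk' hn).trans ?_
  rw [ENNReal.ofReal_coe_nnreal]
  exact hkε.le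

end Luxemburg

/-! ### A Vitali-type convergence argument. -/

section Vitali

theorem rpow_le_min_rpow_add {r s T a : ℝ} (hrs : r ≤ s) (hT : 0 < T) (ha : 0 ≤ a) :
    a ^ r ≤ min a T ^ r + T ^ (r - s) * a ^ s := by
  rcases le_total a T with h | h
  · rw [min_eq_left h]
    have : 0 ≤ T ^ (r - s) * a ^ s := by positivity
    linarith
  · rw [min_eq_right h]
    have ha0 : 0 < a := hT.trans_le h
    have h1 : a ^ (r - s) ≤ T ^ (r - s) := Real.rpow_le_rpow_of_nonpos hT h (by linarith)
    have h2 : a ^ r = a ^ (r - s) * a ^ s := by rw [← Real.rpow_add ha0]; ring_nf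
    have h3 : a ^ (r - s) * a ^ s ≤ T ^ (r - s) * a ^ s := by gcongr
    have h4 : 0 ≤ T ^ r := by positivity
    linarith

/-- Almost everywhere convergence to zero and a bound in a higher power give convergence of the
integrals. -/
theorem tendsto_lintegral_rpow_zero {X : Type*} [MeasurableSpace X] {μ : Measure X}
    [IsFiniteMeasure μ] {F : ℕ → X → ℝ} (hF : ∀ n, AEMeasurable (F n) μ) (hF0 : ∀ n x, 0 ≤ F n x)
    (hlim : ∀ᵐ x ∂μ, Tendsto (fun n => F n x) atTop (𝓝 0)) {r s : ℝ} (hr : 0 < r) (hrs : r < s)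
    {C : ℝ≥0∞} (hC : C ≠ ∞) (hb : ∀ n, ∫⁻ x, ENNReal.ofReal (F n x ^ s) ∂μ ≤ C) :
    Tendsto (fun n => ∫⁻ x, ENNReal.ofReal (F n x ^ r) ∂μ) atTop (𝓝 0) := by
  rw [ENNReal.tendsto_nhds_zero]
  intro ε hε
  have hε2 : 0 < ε / 2 := ENNReal.div_pos hε.ne' (by simp)
  -- Truncation at `T` makes the tail small uniformly in `n`, since `r < s`; the truncated part is
  -- dominated by the constant `T^r`.
  obtain ⟨T, hT, hT0⟩ : ∃ T : ℝ, ENNReal.ofReal (T ^ (r - s)) * C < ε / 2 ∧ 0 < T := by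
    have h1 : Tendsto (fun T : ℝ => T ^ (r - s)) atTop (𝓝 0) := by
      simpa using tendsto_rpow_neg_atTop (sub_pos.2 hrs)
    have h2 := ENNReal.Tendsto.mul_const (b := C) (ENNReal.tendsto_ofReal h1) (Or.inr hC)
    rw [ENNReal.ofReal_zero, zero_mul] at h2
    exact ((h2.eventually_lt_const hε2).and (eventually_gt_atTop 0)).exists
  have hmin : ∀ n, AEMeasurable (fun x => ENNReal.ofReal (min (F n x) T ^ r)) μ := fun n =>
    (((hF n).min aemeasurable_const).pow_const r).ennreal_ofReal
  have hdom : Tendsto (fun n => ∫⁻ x, ENNReal.ofReal (min (F n x) T ^ r) ∂μ) atTop (𝓝 0) := by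
    have := tendsto_lintegral_of_dominated_convergence' (μ := μ) (f := fun _ => 0)
      (F := fun n x => ENNReal.ofReal (min (F n x) T ^ r)) (fun _ => ENNReal.ofReal (T ^ r))
      hmin (fun n => ?_) ?_ ?_
    · simpa using this
    · refine Eventually.of_forall fun x => ENNReal.ofReal_le_ofReal ?_
      exact Real.rpow_le_rpow (le_min (hF0 n x) hT0.le) (min_le_right _ _) hr.le
    · simpa using ENNReal.mul_ne_top ENNReal.ofReal_ne_top (measure_ne_top μ Set.univ)
    · filter_upwards [hlim] with x hx
      have h1 := ENNReal.tendsto_ofReal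
        ((hx.min (tendsto_const_nhds (x := T))).rpow_const (p := r) (Or.inr hr.le))
      simpa [min_eq_left hT0.le, Real.zero_rpow hr.ne'] using h1
  filter_upwards [hdom.eventually_le_const hε2] with n hn
  calc ∫⁻ x, ENNReal.ofReal (F n x ^ r) ∂μ
      ≤ ∫⁻ x, (ENNReal.ofReal (min (F n x) T ^ r)
          + ENNReal.ofReal (T ^ (r - s)) * ENNReal.ofReal (F n x ^ s)) ∂μ := by
        refine lintegral_mono fun x => ?_
        have h0 := Real.rpow_nonneg (hF0 n x) s
        have h1 := Real.rpow_nonneg (le_min (hF0 n x) hT0.le) r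
        rw [← ENNReal.ofReal_mul (by positivity), ← ENNReal.ofReal_add h1 (by positivity)]
        exact ENNReal.ofReal_le_ofReal (rpow_le_min_rpow_add hrs.le hT0 (hF0 n x))
    _ ≤ ε / 2 + ε / 2 := by
        rw [lintegral_add_left' (hmin n), lintegral_const_mul' _ _ ENNReal.ofReal_ne_top]
        exact add_le_add hn ((mul_le_mul_right (hb n) _).trans hT.le)
    _ = ε := ENNReal.add_halves ε

theorem add_rpow_le {a b s : ℝ} (ha : 0 ≤ a) (hb : 0 ≤ b) (hs : 0 ≤ s) :
    (a + b) ^ s ≤ 2 ^ s * (a ^ s + b ^ s) := by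
  have key : ∀ c : ℝ, 0 ≤ c → a ≤ c → b ≤ c → (a + b) ^ s ≤ 2 ^ s * c ^ s := fun c hc h1 h2 => by
    rw [← Real.mul_rpow zero_le_two hc]
    exact Real.rpow_le_rpow (by positivity) (by linarith) hs
  have ha' := Real.rpow_nonneg ha s
  have hb' := Real.rpow_nonneg hb s
  rcases le_total a b with h | h
  · exact (key b hb h le_rfl).trans (by gcongr; linarith)
  · exact (key a ha le_rfl h).trans (by gcongr; linarith)

end Vitali

/-! ### Boundedness and compactness of the embedding. -/

section Embedding

variable {N : ℕ} {J : Space N → ℝ} {p q : ℝ} {Ψ : ℝ → ℝ}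

/-- For `L` above the norm, `u / L` lies in the unit balls of both modulars, so `∫ Ψ(u / L)^r ≤ C`.
Dividing further by `D = max 1 C` gains `D^(-r) ≤ D^(-1)` by convexity and `r ≥ 1`, bringing the
integral below `1`. -/
theorem orliczNorm_rpow_le (hΨ : YoungClass p q Ψ) {r : ℝ} (hr : 1 ≤ r) {Ω : Set (Space N)}
    {C : ℝ≥0} (hC : ∀ u : Space N → ℝ, AEMeasurable u → modular Ψ volume u ≤ (1 : ℝ≥0) →
      energy J Ψ u ≤ (1 : ℝ≥0) → ∫⁻ x, ENNReal.ofReal (Ψ (u x) ^ r) ≤ C)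
    {u : Space N → ℝ} (hu : AEMeasurable u) :
    orliczNorm (fun s => Ψ s ^ r) (volume.restrict Ω) u ≤ (max 1 C : ℝ≥0) * wNorm J Ψ u := by
  set D : ℝ≥0 := max 1 C with hD
  have hD1 : (1 : ℝ) ≤ D := by exact_mod_cast le_max_left 1 C
  have hD0 : (0 : ℝ) < D := by linarith
  have hDpos : (D : ℝ≥0∞) ≠ 0 := by
    rw [ENNReal.coe_ne_zero]; exact fun h => by simp [h] at hD0
  rw [← ENNReal.div_le_iff' hDpos ENNReal.coe_ne_top]
  refine le_of_forall_gt_imp_ge_of_dense fun a ha => ?_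
  rcases eq_or_ne a ∞ with rfl | hat
  · exact le_top
  rw [ENNReal.div_le_iff' hDpos ENNReal.coe_ne_top]
  set L := a.toReal with hL
  have haL : a = ENNReal.ofReal L := (ENNReal.ofReal_toReal hat).symm
  have hL0 : 0 < L := ENNReal.toReal_pos (ne_bot_of_gt ha) hat
  obtain ⟨h1, h2⟩ := modular_energy_le_one_of_wNorm_lt hΨ (haL ▸ ha)
  have h3 := hC _ (hu.div_const L) (by simpa using h1) (by simpa using h2)
  rw [haL, ← ENNReal.ofReal_coe_nnreal, ← ENNReal.ofReal_mul hD0.le]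
  refine luxemburg_le (by positivity) ?_
  calc modular (fun s => Ψ s ^ r) (volume.restrict Ω) (fun x => u x / (D * L))
      ≤ ∫⁻ x, ENNReal.ofReal (Ψ (u x / (D * L)) ^ r) := setLIntegral_le_lintegral _ _
    _ ≤ ∫⁻ x, ENNReal.ofReal ((D : ℝ)⁻¹) * ENNReal.ofReal (Ψ (u x / L) ^ r) := by
        refine lintegral_mono fun x => ?_
        rw [← ENNReal.ofReal_mul (by positivity)]
        refine ENNReal.ofReal_le_ofReal ?_
        have h4 := hΨ.map_mul_le (inv_nonneg.2 hD0.le) (inv_le_one_of_one_le₀ hD1) (u x / L)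
        rw [show (D : ℝ)⁻¹ * (u x / L) = u x / (D * L) by field_simp] at h4
        have h5 := hΨ.nonneg (u x / L)
        calc Ψ (u x / (D * L)) ^ r ≤ ((D : ℝ)⁻¹ * Ψ (u x / L)) ^ r :=
              Real.rpow_le_rpow (hΨ.nonneg _) h4 (by linarith)
          _ = (D : ℝ)⁻¹ ^ r * Ψ (u x / L) ^ r := Real.mul_rpow (by positivity) h5
          _ ≤ _ := by
              have h6 : (D : ℝ)⁻¹ ^ r ≤ (D : ℝ)⁻¹ := by
                simpa using Real.rpow_le_rpow_of_exponent_ge (inv_pos.2 hD0)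
                  (inv_le_one_of_one_le₀ hD1) hr
              gcongr
    _ ≤ ENNReal.ofReal ((D : ℝ)⁻¹) * C := by
        rw [lintegral_const_mul' _ _ ENNReal.ofReal_ne_top]
        gcongr
    _ ≤ 1 := by
        rw [← ENNReal.ofReal_coe_nnreal, ← ENNReal.ofReal_mul (by positivity),
          ENNReal.ofReal_le_one, inv_mul_le_one₀ hD0]
        exact_mod_cast le_max_right 1 C

/-- Fatou's lemma and continuity of `Ψ`. -/
theorem lintegral_rpow_le_of_tendsto_ae (hΨ : YoungClass p q Ψ) {μ : Measure (Space N)} {t : ℝ}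
    (ht : 0 ≤ t) {C : ℝ≥0∞} {w : ℕ → Space N → ℝ} {v : Space N → ℝ}
    (hw : ∀ n, AEMeasurable (w n) μ) (hC : ∀ n, ∫⁻ x, ENNReal.ofReal (Ψ (w n x) ^ t) ∂μ ≤ C)
    (hlim : ∀ᵐ x ∂μ, Tendsto (fun n => w n x) atTop (𝓝 (v x))) :
    ∫⁻ x, ENNReal.ofReal (Ψ (v x) ^ t) ∂μ ≤ C := by
  calc ∫⁻ x, ENNReal.ofReal (Ψ (v x) ^ t) ∂μ
      = ∫⁻ x, liminf (fun n => ENNReal.ofReal (Ψ (w n x) ^ t)) atTop ∂μ := by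
        refine lintegral_congr_ae ?_
        filter_upwards [hlim] with x hx
        have h1 := (hΨ.differentiable.continuous.tendsto (v x)).comp hx
        exact (ENNReal.tendsto_ofReal (h1.rpow_const (Or.inr ht))).liminf_eq.symm
    _ ≤ liminf (fun n => ∫⁻ x, ENNReal.ofReal (Ψ (w n x) ^ t) ∂μ) atTop :=
        lintegral_liminf_le' fun n =>
          ((hΨ.measurable.comp_aemeasurable (hw n)).pow_const t).ennreal_ofReal
    _ ≤ C := liminf_le_of_le (by isBoundedDefault) fun b hb => by
        obtain ⟨n, hn⟩ := hb.exists
        exact hn.trans (hC n)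

/-- Almost everywhere convergence together with a bound on `∫ Ψ(w)^s` for some `s > r` gives
modular convergence for `Ψ^r`. -/
theorem tendsto_modular_rpow_sub (hΨ : YoungClass p q Ψ) {μ : Measure (Space N)}
    [IsFiniteMeasure μ] {r s : ℝ} (hr : 0 < r) (hrs : r < s) {C : ℝ≥0} {w : ℕ → Space N → ℝ}
    {v : Space N → ℝ} (hw : ∀ n, AEMeasurable (w n) μ) (hv : AEMeasurable v μ)
    (hC : ∀ n, ∫⁻ x, ENNReal.ofReal (Ψ (w n x) ^ s) ∂μ ≤ C)
    (hlim : ∀ᵐ x ∂μ, Tendsto (fun n => w n x) atTop (𝓝 (v x))) {k : ℝ} (hk : 0 < k) :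
    Tendsto (fun n => modular (fun t => Ψ t ^ r) μ fun x => (w n x - v x) / k) atTop (𝓝 0) := by
  have hs : 0 < s := hr.trans hrs
  set D : ℝ := (max 1 (2 / k)) ^ p with hD
  have hD0 : 0 ≤ D := Real.rpow_nonneg (zero_le_one.trans (le_max_left _ _)) _
  have hDs : 0 ≤ D ^ s * 2 ^ s := by positivity
  refine tendsto_lintegral_rpow_zero (F := fun n x => Ψ ((w n x - v x) / k))
    (fun n => hΨ.measurable.comp_aemeasurable (((hw n).sub hv).div_const k))
    (fun n x => hΨ.nonneg _) ?_ hr hrs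
    (C := ENNReal.ofReal (D ^ s * 2 ^ s) * (C + C)) ?_ fun n => ?_
  · filter_upwards [hlim] with x hx
    have h1 := (hΨ.differentiable.continuous.tendsto _).comp ((hx.sub_const (v x)).div_const k)
    simpa [hΨ.map_zero, Function.comp_def] using h1
  · exact ENNReal.mul_ne_top ENNReal.ofReal_ne_top (by simp)
  · have hm : AEMeasurable (fun x => ENNReal.ofReal (Ψ (w n x) ^ s)) μ :=
      ((hΨ.measurable.comp_aemeasurable (hw n)).pow_const s).ennreal_ofReal
    calc ∫⁻ x, ENNReal.ofReal (Ψ ((w n x - v x) / k) ^ s) ∂μ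
        ≤ ∫⁻ x, ENNReal.ofReal (D ^ s * 2 ^ s) *
          (ENNReal.ofReal (Ψ (w n x) ^ s) + ENNReal.ofReal (Ψ (v x) ^ s)) ∂μ := by
          refine lintegral_mono fun x => ?_
          have h1 := hΨ.nonneg (w n x)
          have h2 := hΨ.nonneg (v x)
          rw [← ENNReal.ofReal_add (by positivity) (by positivity), ← ENNReal.ofReal_mul hDs]
          refine ENNReal.ofReal_le_ofReal ?_
          calc Ψ ((w n x - v x) / k) ^ s ≤ (D * (Ψ (w n x) + Ψ (v x))) ^ s :=
                Real.rpow_le_rpow (hΨ.nonneg _) (hΨ.map_sub_div_le hk _ _) hs.le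
            _ = D ^ s * (Ψ (w n x) + Ψ (v x)) ^ s := Real.mul_rpow hD0 (by positivity)
            _ ≤ D ^ s * (2 ^ s * (Ψ (w n x) ^ s + Ψ (v x) ^ s)) := by
                gcongr; exact add_rpow_le h1 h2 hs.le
            _ = _ := by ring
      _ ≤ _ := by
          rw [lintegral_const_mul' _ _ ENNReal.ofReal_ne_top, lintegral_add_left' hm]
          gcongr
          · exact hC n
          · exact lintegral_rpow_le_of_tendsto_ae hΨ hs.le hw hC hlim

theorem compactEmbedding_rpow (hN : 0 < N) (hΨ : YoungClass p q Ψ) {Ω : Set (Space N)}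
    (hΩ : volume Ω ≠ ∞) {α : ℝ} (hα : 0 < α) (hJ : PowerLowerBound J α) {r : ℝ} (hr : 1 ≤ r)
    (hrα : α < (N : ℝ) → r < (N : ℝ) / ((N : ℝ) - α)) :
    CompactEmbedding J Ψ Ω (fun s => Ψ s ^ r) := by
  obtain ⟨s, hrs, hs⟩ := exists_lintegral_rpow_le hN hΨ hα hJ hrα
  have hr0 : 0 < r := by linarith
  have : IsFiniteMeasure (volume.restrict Ω) := isFiniteMeasure_restrict.2 hΩ
  refine ⟨fun u hu => ⟨hu.1.1.1.restrict, ?_⟩, ?_, fun u hu hK => ?_⟩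
  · obtain ⟨⟨⟨hum, hM⟩, hE⟩, -⟩ := hu
    obtain ⟨C, hC⟩ := hs r hr hrs.le
      (max (modular Ψ volume u).toNNReal (energy J Ψ u).toNNReal)
    have h1 := hC u hum
      (by rw [← ENNReal.coe_toNNReal hM.ne]; exact_mod_cast le_max_left _ _)
      (by rw [← ENNReal.coe_toNNReal hE.ne]; exact_mod_cast le_max_right _ _)
    exact (setLIntegral_le_lintegral _ _).trans_lt (h1.trans_lt ENNReal.coe_lt_top)
  · obtain ⟨C, hC⟩ := hs r hr hrs.le 1
    exact ⟨max 1 C, fun u hu => orliczNorm_rpow_le hΨ hr hC hu.1.1.1⟩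
  · obtain ⟨K, hK⟩ := hK
    -- `L` is strictly above all the norms, and `L ≥ 1` permits the growth bound for `Ψ(L v)` below.
    set L : ℝ := K + 1 with hL
    have hL1 : 1 ≤ L := by simp [hL]
    have hL0 : 0 < L := by linarith
    have hlt : ∀ n, wNorm J Ψ (u n) < ENNReal.ofReal L := fun n => (hK n).trans_lt (by
      rw [← ENNReal.ofReal_coe_nnreal, ENNReal.ofReal_lt_ofReal_iff hL0]; simp [hL])
    set w : ℕ → Space N → ℝ := fun n x => u n x / L with hw
    have hwm : ∀ n, AEMeasurable (w n) := fun n => (hu n).1.1.1.div_const L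
    have hM : ∀ n, modular Ψ volume (w n) ≤ (1 : ℝ≥0) := fun n => by
      simpa using (modular_energy_le_one_of_wNorm_lt hΨ (hlt n)).1
    have hE : ∀ n, energy J Ψ (w n) ≤ (1 : ℝ≥0) := fun n => by
      simpa using (modular_energy_le_one_of_wNorm_lt hΨ (hlt n)).2
    obtain ⟨φ, hφ, v, hv, hlim⟩ :=
      exists_subseq_tendsto_ae hN hΨ hα hJ hΩ 1 w hwm hM hE
    have hbound : ∀ t, 1 ≤ t → t ≤ s → ∃ C : ℝ≥0, ∀ n,
        ∫⁻ x in Ω, ENNReal.ofReal (Ψ (w (φ n) x) ^ t) ≤ C := fun t h1 h2 => by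
      obtain ⟨C, hC⟩ := hs t h1 h2 1
      exact ⟨C, fun n => (setLIntegral_le_lintegral _ _).trans (hC _ (hwm _) (hM _) (hE _))⟩
    refine ⟨φ, hφ, fun x => L * v x, ⟨hv.const_mul L, ?_⟩, tendsto_orliczNorm_zero fun k hk => ?_⟩
    · obtain ⟨C, hC⟩ := hbound r hr hrs.le
      have hvC := lintegral_rpow_le_of_tendsto_ae hΨ hr0.le (fun n => (hwm (φ n)).restrict) hC hlim
      calc modular (fun s => Ψ s ^ r) (volume.restrict Ω) (fun x => L * v x)
          ≤ ∫⁻ x in Ω, ENNReal.ofReal ((L ^ p) ^ r) * ENNReal.ofReal (Ψ (v x) ^ r) := by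
            refine lintegral_mono fun x => ?_
            rw [← ENNReal.ofReal_mul (by positivity),
              ← Real.mul_rpow (by positivity) (hΨ.nonneg _)]
            exact ENNReal.ofReal_le_ofReal
              (Real.rpow_le_rpow (hΨ.nonneg _) (hΨ.map_mul_le_rpow hL1 _) hr0.le)
        _ < ∞ := by
            rw [lintegral_const_mul' _ _ ENNReal.ofReal_ne_top]
            exact ENNReal.mul_lt_top ENNReal.ofReal_lt_top (hvC.trans_lt ENNReal.coe_lt_top)
    -- Undoing the normalisation, `(u - L v) / k = (w - v) / (k / L)`, so convergence is needed at
    -- the scale `k / L`.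
    · obtain ⟨C, hC⟩ := hbound s (hr.trans hrs.le) le_rfl
      have := tendsto_modular_rpow_sub hΨ hr0 hrs (fun n => (hwm (φ n)).restrict) hv hC hlim
        (div_pos hk hL0)
      refine this.congr fun n => ?_
      congr 1
      ext x
      simp only [hw]
      field_simp

end Embedding

end NonlocalOrlicz

theorem theorem3p4 (N : ℕ) (hN : 0 < N)
    (J : NonlocalOrlicz.Space N → ℝ) (hJ : NonlocalOrlicz.IsKernel J)
    (p q : ℝ) (hqp : q ≤ p) (hq : max (NonlocalOrlicz.qStar J) 1 < q)
    (Ψ : ℝ → ℝ) (hΨ : NonlocalOrlicz.YoungClass p q Ψ)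
    (Ω : Set (NonlocalOrlicz.Space N)) (hΩo : IsOpen Ω) (hΩb : Bornology.IsBounded Ω)
    (α : ℝ) (hα : 0 < α) (hJα : NonlocalOrlicz.PowerLowerBound J α)
    (hJm : NonlocalOrlicz.AlmostDecreasing J)
    (r : ℝ) (hr : 1 ≤ r) (hrα : α < (N : ℝ) → r < (N : ℝ) / ((N : ℝ) - α)) :
    NonlocalOrlicz.CompactEmbedding J Ψ Ω (fun s => Ψ s ^ r) :=
  NonlocalOrlicz.compactEmbedding_rpow hN hΨ hΩb.measure_lt_top.ne hα hJα hr hrα
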